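/- Let $\lambda,\lambda_1,\beta>0$ and let $n\ge 1$ be an integer. Let $G^{(n)}_N(t)=\sum_{i=1}^{N(t)}G_i$, $t\ge0$, be the compound Poisson--Erlang process, where $N$ is a Poisson process with intensity $\lambda$ and the $G_i$ are i.i.d. random variables, independent of $N$, with the Gamma density $\frac{\beta^n}{\Gamma(n)}x^{n-1}e^{-\beta x}$, $x\ge 0$. Let $$Y^{(n)}(t)=\inf\{u\ge 0:\ G^{(n)}_N(u)>t\},\qquad t\ge 0,$$ be its inverse process, let $N_1$ be a Poisson process with intensity $\lambda_1$ that is independent of $Y^{(n)}$, and put $Z^{(n)}(t)=N_1(Y^{(n)}(t))$. For $\rho,\delta,\gamma>0$ write $$\mathcal E_{\rho,\delta}(z)=\sum_{j=0}^\infty \frac{z^j}{\Gamma(\rho j+\delta)},\qquad \mathcal E^{\gamma}_{\rho,\delta}(z)=\sum_{j=0}^\infty \frac{\Gamma(\gamma+j)}{\Gamma(\gamma)}\,\frac{z^j}{j!\,\Gamma(\rho j+\delta)}$$ for the two- and three-parameter Mittag-Leffler functions. Then for every $t\ge 0$ (with $0^0=1$): (i) for every integer $k\ge 0$, $$P\big(Z^{(n)}(t)=k\big)=e^{-\beta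 t}\,\frac{\lambda\lambda_1^{k}}{(\lambda_1+\lambda)^{k+1}}\sum_{m=1}^{n}(\beta t)^{m-1}\,\mathcal E^{k+1}_{n,m}\!\left(\frac{\lambda(\beta t)^n}{\lambda_1+\lambda}\right);$$ (ii) for every real $\theta$ with $\lambda+\lambda_1(1-e^{-\theta})>0$ (in particular for every $\theta\ge0$), $e^{-\theta Z^{(n)}(t)}$ is integrable and $$E\big[e^{-\theta Z^{(n)}(t)}\big]=e^{-\beta t}\,\frac{\lambda}{\lambda+\lambda_1(1-e^{-\theta})}\sum_{m=1}^{n}(\beta t)^{m-1}\,\mathcal E_{n,m}\!\left(\frac{\lambda(\beta t)^n}{\lambda+\lambda_1(1-e^{-\theta})}\right).$$ -/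

import Mathlib

open MeasureTheory ProbabilityTheory Filter Topology
open scoped NNReal

/-- Two-parameter Mittag-Leffler function `E_{ρ,δ}(z) = ∑ⱼ z ^ j / Γ(ρ j + δ)`
at real arguments. -/
noncomputable def mittagLefflerTwo (ρ δ z : ℝ) : ℝ :=
  ∑' j : ℕ, z ^ j / Real.Gamma (ρ * j + δ)

/-- Three-parameter Mittag-Leffler function
`E^γ_{ρ,δ}(z) = ∑ⱼ (Γ(γ + j) / Γ(γ)) z ^ j / (j! Γ(ρ j + δ))` at real arguments. -/
noncomputable def mittagLefflerThree (ρ δ γ z : ℝ) : ℝ :=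
  ∑' j : ℕ, Real.Gamma (γ + j) / Real.Gamma γ *
    (z ^ j / ((Nat.factorial j : ℝ) * Real.Gamma (ρ * j + δ)))

/-- `N` is a Poisson process with intensity `lam` under `P`: it starts at `0`, has independent
increments, its increments over `[s, t]` are Poisson with parameter `lam * (t - s)`, and almost
all of its paths are right-continuous with left limits. Increments are taken in `ℤ`, since
subtraction in `ℕ` is truncated. -/
structure IsPoissonProcess {Ω : Type*} [MeasurableSpace Ω] (N : ℝ≥0 → Ω → ℕ) (lam : ℝ≥0)
    (P : Measure Ω) : Prop where
  measurable : ∀ t, Measurable (N t)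
  start_zero : ∀ᵐ ω ∂P, N 0 ω = 0
  indep_increments : HasIndepIncrements (fun t ω => (N t ω : ℤ)) P
  increment_law : ∀ s t, s ≤ t →
    HasLaw (fun ω => (N t ω : ℤ) - (N s ω : ℤ))
      ((poissonMeasure (lam * (t - s))).map (fun k : ℕ => (k : ℤ))) P
  cadlag : ∀ᵐ ω ∂P, ∀ t, ContinuousWithinAt (fun s => N s ω) (Set.Ici t) t ∧
    ∃ l, Tendsto (fun s => N s ω) (𝓝[<] t) (𝓝 l)

/-- `X` is a compound Poisson-Gamma process with intensity `lam`, jump shape `α` and jump rate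
`β`: up to indistinguishability, `X t = ∑_{i < N t} J i`, where `N` is a Poisson process with
intensity `lam` and the jumps `J i` are i.i.d. with law `Gamma(α, β)`, independent of `N`. -/
def IsCompoundPoissonGamma {Ω : Type*} [MeasurableSpace Ω] (X : ℝ≥0 → Ω → ℝ) (lam : ℝ≥0)
    (α β : ℝ) (P : Measure Ω) : Prop :=
  ∃ (N : ℝ≥0 → Ω → ℕ) (J : ℕ → Ω → ℝ),
    IsPoissonProcess N lam P ∧
    (∀ i, Measurable (J i)) ∧
    (∀ i, HasLaw (J i) (gammaMeasure α β) P) ∧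
    iIndepFun J P ∧
    IndepFun (fun ω t => N t ω) (fun ω i => J i ω) P ∧
    ∀ᵐ ω ∂P, ∀ t, X t ω = ∑ i ∈ Finset.range (N t ω), J i ω

/-- The inverse (first passage time) process `Y(t) = inf {u ≥ 0 : X(u) > t}`. -/
noncomputable def inverseProcess {Ω : Type*} (X : ℝ≥0 → Ω → ℝ) (t : ℝ≥0) (ω : Ω) : ℝ≥0 :=
  sInf {u : ℝ≥0 | (t : ℝ) < X u ω}

/-- The time-changed process `Z(t) = N(Y(t))`. -/
def timeChange {Ω : Type*} (N : ℝ≥0 → Ω → ℕ) (Y : ℝ≥0 → Ω → ℝ≥0) (t : ℝ≥0) (ω : Ω) : ℕ :=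
  N (Y t ω) ω

/-!
The proof reads the jumps of size `Gamma(n, β)` as blocks of `n` exponential phases. The number `I`
of phases completed within the level `t` is Poisson with mean `β t`, so `⌊I / n⌋` jumps stay below
`t`, and the passage happens at jump number `⌊I / n⌋ + 1` of `N`, that is, at a
`Gamma(⌊I / n⌋ + 1, lam)` time. Hence `Y(t)` is distributed as the mixture `erlangPassageLaw`.
Formally this is a comparison of tails, `P(Y(t) > u) = P(X(u) ≤ t)`, which uses the monotone
right-continuous paths of `X` (`lt_sInf_setOf_lt_iff`), the law of a sum of gamma variables
(`hasLaw_sum_range_gammaMeasure`) and the identity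
`Gamma(m + 1, r)(u, ∞) = Poisson(r u){0, …, m}` (`gammaMeasure_Ioi`), applied once in the level and
once in time; see `IsCompoundPoissonGamma.hasLaw_inverseProcess`.

By right-continuity of `N1` and independence, `N1(Y(t))` is a mixture of Poisson laws with parameter
`lam1 Y(t)` (`IsPoissonProcess.measure_comp`), and a Poisson variable with a `Gamma(j + 1, lam)`
parameter is negative binomial (`lintegral_poissonMeasure_singleton_gammaMeasure`). So
`P(N1(Y(t)) = k)` is the Poisson(`β t`) average over `i` of negative binomial weights with
`j = ⌊i / n⌋`, and the Laplace transform is the same average of powers of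
`lam / (lam + lam1 (1 - exp (-θ)))`. Writing `i = n j + (m - 1)` with `1 ≤ m ≤ n` turns either
series into `n` Mittag-Leffler series (`tsum_poisson_mul_div`).
-/

/-! ### Gamma laws with integer shape -/

/-- The derivative of minus a partial sum of the Poisson weights telescopes to a gamma density. The
function `c` stands for the identity of `ℝ` or for the coercion from `ℝ` to `ℂ`, and `e` for
`x ↦ exp (-(r x))`. -/
theorem hasDerivAt_neg_sum_mul_pow_div_factorial {𝕜 : Type*} [RCLike 𝕜] {r : 𝕜}
    {c e : ℝ → 𝕜} {x : ℝ} (hc : HasDerivAt c 1 x) (he : HasDerivAt e (-(r * e x)) x) (m : ℕ) :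
    HasDerivAt (fun x : ℝ => -∑ i ∈ Finset.range (m + 1), e x * (r * c x) ^ i / i.factorial)
      (r ^ (m + 1) / m.factorial * c x ^ m * e x) x := by
  induction m with
  | zero =>
    simp only [zero_add, Finset.sum_range_one, pow_zero, mul_one, Nat.factorial_zero, Nat.cast_one,
      div_one, pow_one]
    simpa using he.fun_neg
  | succ m ih =>
    have h := ih.fun_sub ((he.fun_mul
      ((hc.const_mul r).fun_pow (m + 1))).div_const ((m + 1).factorial : 𝕜))
    refine (h.congr_of_eventuallyEq (Eventually.of_forall fun y => ?_)).congr_deriv ?_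
    · dsimp only
      rw [Finset.sum_range_succ _ (m + 1)]
      ring
    · rw [Nat.factorial_succ, Nat.add_sub_cancel]
      have : (m.factorial : 𝕜) ≠ 0 := by exact_mod_cast m.factorial_ne_zero
      have : (m + 1 : 𝕜) ≠ 0 := by exact_mod_cast m.succ_ne_zero
      push_cast
      field_simp
      ring

open Set in
/-- The `(m + 1)`-st point of a Poisson process of rate `r` lies beyond `u` exactly when there are
at most `m` points up to `u`. -/
theorem gammaMeasure_Ioi (m : ℕ) {r : ℝ≥0} (hr : 0 < r) (u : ℝ≥0) :
    gammaMeasure (m + 1) r (Ioi (u : ℝ)) = poissonMeasure (r * u) (Iic m) := by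
  have hr' : (0 : ℝ) < r := hr
  have hderiv (x : ℝ) := hasDerivAt_neg_sum_mul_pow_div_factorial (r := (r : ℝ))
    (c := fun x => x)
    (e := fun x => Real.exp (-(r * x))) (hasDerivAt_id x)
    (by simpa [mul_comm] using (((hasDerivAt_id x).const_mul (r : ℝ)).fun_neg).exp) m
  have hlim : Tendsto (fun x : ℝ => -∑ i ∈ Finset.range (m + 1),
      Real.exp (-(r * x)) * (r * x) ^ i / i.factorial) atTop (𝓝 0) := by
    rw [← neg_zero, ← Finset.sum_const_zero (s := Finset.range (m + 1))]
    refine (tendsto_finsetSum _ fun i _ => ?_).neg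
    have h := ((Real.tendsto_pow_mul_exp_neg_atTop_nhds_zero i).comp
      (tendsto_id.const_mul_atTop hr')).div_const (i.factorial : ℝ)
    simpa [Function.comp_def, mul_comm] using h
  have hnonneg : ∀ x ∈ Ioi (u : ℝ),
      0 ≤ (r : ℝ) ^ (m + 1) / m.factorial * x ^ m * Real.exp (-(r * x)) := by
    intro x hx
    have : 0 ≤ x := u.2.trans (le_of_lt hx)
    positivity
  have hint := integrableOn_Ioi_deriv_of_nonneg' (a := (u : ℝ))
    (fun x _ => hderiv x) hnonneg hlim
  have hval := integral_Ioi_of_hasDerivAt_of_nonneg' (a := (u : ℝ))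
    (fun x _ => hderiv x) hnonneg hlim
  rw [gammaMeasure, withDensity_apply _ measurableSet_Ioi]
  have hcongr : ∫⁻ x in Ioi (u : ℝ), gammaPDF (m + 1) r x = ∫⁻ x in Ioi (u : ℝ),
      ENNReal.ofReal ((r : ℝ) ^ (m + 1) / m.factorial * x ^ m * Real.exp (-(r * x))) := by
    refine setLIntegral_congr_fun measurableSet_Ioi fun x hx => ?_
    rw [gammaPDF_of_nonneg (u.2.trans (le_of_lt hx)), Real.Gamma_nat_eq_factorial,
      add_sub_cancel_right, Real.rpow_natCast]
    norm_cast
  rw [hcongr, ← ofReal_integral_eq_lintegral_ofReal hint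
    ((ae_restrict_iff' measurableSet_Ioi).2 (ae_of_all _ hnonneg)), hval]
  rw [show Iic m = ((Finset.range (m + 1) : Finset ℕ) : Set ℕ) by ext; simp,
    ← sum_measure_singleton, zero_sub]
  rw [neg_neg, ENNReal.ofReal_sum_of_nonneg]
  · exact Finset.sum_congr rfl fun i _ => by rw [poissonMeasure_singleton]; simp
  · intro i _
    positivity

open Set in
theorem gammaMeasure_Iic {n : ℕ} (hn : 1 ≤ n) {r : ℝ≥0} (hr : 0 < r) (u : ℝ≥0) :
    gammaMeasure n r (Iic (u : ℝ)) = poissonMeasure (r * u) (Ici n) := by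
  obtain ⟨m, rfl⟩ := Nat.exists_eq_add_of_le' hn
  have := isProbabilityMeasure_gammaMeasure (a := ((m + 1 : ℕ) : ℝ)) (r := r) (by positivity) hr
  rw [← compl_Ioi, prob_compl_eq_one_sub measurableSet_Ioi,
    show Ici (m + 1) = (Iic m)ᶜ by ext; simp, prob_compl_eq_one_sub .of_discrete,
    ← gammaMeasure_Ioi m hr]
  push_cast
  rfl

open Set Complex in
/-- The gamma integral with integer exponent and a complex rate, as needed for the characteristic
function. -/
theorem integral_Ioi_pow_mul_exp_neg_mul (m : ℕ) {z : ℂ} (hz : 0 < z.re) :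
    ∫ x in Ioi (0 : ℝ), z ^ (m + 1) / m.factorial * (x : ℂ) ^ m * exp (-(z * x)) = 1 := by
  have hderiv (x : ℝ) := hasDerivAt_neg_sum_mul_pow_div_factorial (r := z)
    (c := fun x : ℝ => (x : ℂ))
    (e := fun x : ℝ => exp (-(z * x))) (hasDerivAt_id x).ofReal_comp
    (by simpa [mul_comm] using ((hasDerivAt_id x).ofReal_comp.const_mul z).fun_neg.cexp) m
  have hnorm (i : ℕ) (x : ℝ) (hx : 0 ≤ x) :
      ‖exp (-(z * x)) * (z * x) ^ i‖ = ‖z‖ ^ i * (x ^ i * Real.exp (-(z.re * x))) := by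
    simp [norm_exp, abs_of_nonneg hx]
    ring
  have hlim : Tendsto (fun x : ℝ => -∑ i ∈ Finset.range (m + 1),
      exp (-(z * x)) * (z * x) ^ i / i.factorial) atTop (𝓝 0) := by
    rw [← neg_zero, ← Finset.sum_const_zero (s := Finset.range (m + 1))]
    refine (tendsto_finsetSum _ fun i _ => ?_).neg
    rw [← zero_div (i.factorial : ℂ)]
    refine Tendsto.div_const (tendsto_zero_iff_norm_tendsto_zero.2 ?_) _
    have h := ((Real.tendsto_pow_mul_exp_neg_atTop_nhds_zero i).comp
      (tendsto_id.const_mul_atTop hz)).const_mul (‖z‖ ^ i / z.re ^ i)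
    rw [mul_zero] at h
    refine h.congr' ?_
    filter_upwards [eventually_ge_atTop 0] with x hx
    rw [hnorm i x hx]
    simp only [Function.comp_apply, id, mul_pow]
    field_simp
  have hint : IntegrableOn
      (fun x : ℝ => z ^ (m + 1) / m.factorial * (x : ℂ) ^ m * exp (-(z * x))) (Ioi 0) := by
    have h := (integrableOn_rpow_mul_exp_neg_mul_rpow (s := m) (p := 1) (b := z.re)
      (by linarith [m.cast_nonneg (α := ℝ)]) one_pos hz).const_mul (‖z‖ ^ (m + 1) / m.factorial)
    refine Integrable.mono' h (by fun_prop) ?_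
    filter_upwards [ae_restrict_mem measurableSet_Ioi] with x hx
    have hx' : 0 < x := hx
    simp [norm_exp, abs_of_pos hx']
    apply le_of_eq
    ring
  have := integral_Ioi_of_hasDerivAt_of_tendsto' (fun x _ => hderiv x) hint hlim
  rw [this]
  simp [Finset.sum_range_succ']

open Complex in
theorem charFun_gammaMeasure_natCast {n : ℕ} (hn : 1 ≤ n) {r : ℝ} (hr : 0 < r) (t : ℝ) :
    charFun (gammaMeasure n r) t = (r / (r - t * I)) ^ n := by
  obtain ⟨m, rfl⟩ := Nat.exists_eq_add_of_le' hn
  have hz : 0 < (r - t * I : ℂ).re := by simpa using hr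
  have hz0 : (r - t * I : ℂ) ≠ 0 := fun h => by simp [h] at hz
  rw [charFun_apply_real, gammaMeasure, integral_withDensity_eq_integral_toReal_smul
    (by unfold gammaPDF; fun_prop) (by simp [gammaPDF]),
    ← setIntegral_eq_integral_of_forall_compl_eq_zero (s := Set.Ici (0 : ℝ)) (fun x hx => by
      rw [gammaPDF_of_neg (not_le.1 hx)]; simp), integral_Ici_eq_integral_Ioi,
    ← mul_one ((_ / _ : ℂ) ^ _), ← integral_Ioi_pow_mul_exp_neg_mul m hz, ← integral_const_mul]
  refine setIntegral_congr_fun measurableSet_Ioi fun x hx => ?_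
  have hx' : (0 : ℝ) < x := hx
  have hexp : exp (-((r - t * I) * x)) = exp (-(r * x)) * exp (t * x * I) := by
    rw [← exp_add]; ring_nf
  have hG : Real.Gamma ((m + 1 : ℕ) : ℝ) = m.factorial := by
    exact_mod_cast Real.Gamma_nat_eq_factorial m
  rw [gammaPDF_of_nonneg hx'.le, ENNReal.toReal_ofReal (by positivity), hG, hexp,
    Nat.cast_add_one, add_sub_cancel_right, ← Nat.cast_add_one, Real.rpow_natCast,
    Real.rpow_natCast, real_smul, div_pow]
  push_cast
  field_simp

theorem gammaMeasure_natCast_conv {m n : ℕ} (hm : 1 ≤ m) (hn : 1 ≤ n) {r : ℝ} (hr : 0 < r) :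
    (gammaMeasure m r).conv (gammaMeasure n r) = gammaMeasure (m + n : ℕ) r := by
  have := isProbabilityMeasure_gammaMeasure (a := (m : ℝ)) (r := r) (by positivity) hr
  have := isProbabilityMeasure_gammaMeasure (a := (n : ℝ)) (r := r) (by positivity) hr
  have := isProbabilityMeasure_gammaMeasure (a := ((m + n : ℕ) : ℝ)) (r := r) (by positivity) hr
  refine Measure.ext_of_charFun (funext fun t => ?_)
  rw [charFun_conv, charFun_gammaMeasure_natCast hm hr, charFun_gammaMeasure_natCast hn hr,
    charFun_gammaMeasure_natCast (by omega) hr, pow_add]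

/-- A sum of `j + 1` i.i.d. `Gamma(n, r)` variables has law `Gamma((j + 1) n, r)`. -/
theorem hasLaw_sum_range_gammaMeasure {Ω : Type*} [MeasurableSpace Ω] {P : Measure Ω}
    [IsProbabilityMeasure P] {n : ℕ} (hn : 1 ≤ n) {r : ℝ} (hr : 0 < r) {J : ℕ → Ω → ℝ}
    (hJm : ∀ i, Measurable (J i)) (hJ : ∀ i, HasLaw (J i) (gammaMeasure n r) P)
    (hind : iIndepFun J P) (j : ℕ) :
    HasLaw (∑ i ∈ Finset.range (j + 1), J i) (gammaMeasure ((j + 1) * n : ℕ) r) P := by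
  induction j with
  | zero => simpa using hJ 0
  | succ j ih =>
    have hi := hind.indepFun_finsetSum_of_notMem hJm (s := Finset.range (j + 1)) (i := j + 1)
      (by simp)
    rw [Finset.sum_range_succ, add_mul (j + 1), one_mul,
      ← gammaMeasure_natCast_conv (Nat.mul_pos j.succ_pos hn) hn hr]
    have := isProbabilityMeasure_gammaMeasure (a := (n : ℝ)) (r := r) (by positivity) hr
    have := isProbabilityMeasure_gammaMeasure (a := ((j + 1) * n : ℕ)) (r := r) (by positivity) hr
    exact hi.hasLaw_add ih (hJ (j + 1))

theorem gammaMeasure_Iio_zero (a r : ℝ) : gammaMeasure a r (Set.Iio 0) = 0 := by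
  rw [gammaMeasure, withDensity_apply _ measurableSet_Iio]
  exact lintegral_gammaPDF_of_nonpos le_rfl

/-! ### The mixture of gamma laws -/

/-- The mixture of the laws `Gamma(⌊i / n⌋ + 1, lam)`, where `i` is a Poisson variable of mean `b`.
It is the law of `Y(t)` for `b = β t`: if every `Gamma(n, β)` jump is cut into `n` exponential
phases, then `i` counts the phases completed within the level `t`, so that `⌊i / n⌋` jumps stay
below `t` and the jump number `⌊i / n⌋ + 1` of `N` carries the process over `t`. -/
noncomputable def erlangPassageLaw (n : ℕ) (lam b : ℝ≥0) : Measure ℝ :=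
  Measure.sum fun i : ℕ => poissonMeasure b {i} • gammaMeasure ((i / n : ℕ) + 1) lam

open Set in
theorem tsum_poissonMeasure_singleton (r : ℝ≥0) : ∑' i : ℕ, poissonMeasure r {i} = 1 := by
  rw [← measure_univ (μ := poissonMeasure r),
    ← Measure.tsum_indicator_apply_singleton _ univ .univ, indicator_univ]

theorem isProbabilityMeasure_erlangPassageLaw (n : ℕ) {lam : ℝ≥0} (hlam : 0 < lam) (b : ℝ≥0) :
    IsProbabilityMeasure (erlangPassageLaw n lam b) where
  measure_univ := by
    have (i : ℕ) := isProbabilityMeasure_gammaMeasure (a := (i / n : ℕ) + 1) (r := lam)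
      (by positivity) hlam
    simp [erlangPassageLaw, tsum_poissonMeasure_singleton]

open Set in
/-- If `i` phases and `j` jumps are independent Poisson variables of means `b` and `lam u`, then
both sides are the probability of `n j ≤ i`. -/
theorem erlangPassageLaw_Ioi {n : ℕ} (hn : 1 ≤ n) {lam : ℝ≥0} (hlam : 0 < lam) (b u : ℝ≥0) :
    erlangPassageLaw n lam b (Ioi (u : ℝ)) =
      ∑' j : ℕ, poissonMeasure (lam * u) {j} * poissonMeasure b (Ici (j * n)) := by
  rw [erlangPassageLaw, Measure.sum_apply _ measurableSet_Ioi]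
  have hsum (r : ℝ≥0) (s : Set ℕ) :
      poissonMeasure r s = ∑' i, s.indicator (fun i => poissonMeasure r {i}) i :=
    (Measure.tsum_indicator_apply_singleton _ _ .of_discrete).symm
  simp_rw [Measure.smul_apply, gammaMeasure_Ioi _ hlam, hsum _ (Iic _), hsum _ (Ici _),
    smul_eq_mul, ← ENNReal.tsum_mul_left]
  rw [ENNReal.tsum_comm]
  refine tsum_congr fun j => tsum_congr fun i => ?_
  simp only [indicator_apply, mem_Iic, mem_Ici, Nat.le_div_iff_mul_le hn]
  split_ifs <;> simp [mul_comm]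

/-! ### Paths of a Poisson process -/

namespace IsPoissonProcess

variable {Ω : Type*} [MeasurableSpace Ω] {N : ℝ≥0 → Ω → ℕ} {lam : ℝ≥0} {P : Measure Ω}

theorem measure_eq (hN : IsPoissonProcess N lam P) (u : ℝ≥0) (j : ℕ) :
    P {ω | N u ω = j} = poissonMeasure (lam * u) {j} := by
  have h := (hN.increment_law 0 u zero_le).measure_eq (p := fun z => z = (j : ℤ))
    .of_discrete
  rw [Measure.map_apply .of_discrete .of_discrete, tsub_zero] at h
  rw [show ({j} : Set ℕ) = (fun k : ℕ => (k : ℤ)) ⁻¹' {x | x = (j : ℤ)} by ext; simp, ← h]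
  refine measure_congr ?_
  filter_upwards [hN.start_zero] with ω hω
  refine propext ?_
  change N u ω = j ↔ (N u ω : ℤ) - N 0 ω = j
  rw [hω]
  simp

theorem ae_right_eventually_eq (hN : IsPoissonProcess N lam P) :
    ∀ᵐ ω ∂P, ∀ u, ∀ᶠ v in 𝓝[≥] u, N v ω = N u ω := by
  filter_upwards [hN.cadlag] with ω hω u
  exact (hω u).1.eventually ((isOpen_discrete {N u ω}).mem_nhds rfl)

theorem ae_monotone (hN : IsPoissonProcess N lam P) : ∀ᵐ ω ∂P, Monotone fun u => N u ω := by
  obtain ⟨D, hDc, hD⟩ := TopologicalSpace.exists_countable_dense ℝ≥0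
  have hle : ∀ᵐ ω ∂P, ∀ s ∈ D, ∀ t ∈ D, s ≤ t → N s ω ≤ N t ω := by
    rw [ae_ball_iff hDc]
    intro s _
    rw [ae_ball_iff hDc]
    intro t _
    by_cases hst : s ≤ t
    · have h := ((hN.increment_law s t hst).ae_iff (p := fun z : ℤ => 0 ≤ z)
        .of_discrete).2 ((ae_map_iff .of_discrete .of_discrete).2 (ae_of_all _ fun k => by simp))
      filter_upwards [h] with ω hω _
      omega
    · exact ae_of_all _ fun ω h => absurd h hst
  filter_upwards [hle, hN.ae_right_eventually_eq] with ω h1 h2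
  -- Right limits along `D` transfer the order from `D` to all times.
  have hex (u w : ℝ≥0) (huw : u < w) : ∃ q ∈ D, u < q ∧ q < w ∧ N q ω = N u ω := by
    have hev : ∀ᶠ v in 𝓝[>] u, v < w ∧ N v ω = N u ω :=
      (eventually_nhdsWithin_of_eventually_nhds (eventually_lt_nhds huw)).and
        ((h2 u).filter_mono (nhdsWithin_mono _ Set.Ioi_subset_Ici_self))
    obtain ⟨z, hz, hsub⟩ := (mem_nhdsGT_iff_exists_Ioo_subset' huw).1 hev
    obtain ⟨q, hqD, hq⟩ := hD.exists_between hz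
    exact ⟨q, hqD, hq.1, hsub hq⟩
  intro s t hst
  rcases hst.eq_or_lt with rfl | hst
  · exact le_rfl
  · obtain ⟨q, hq, -, hqt, hqe⟩ := hex s t hst
    obtain ⟨q', hq', htq, -, hqe'⟩ := hex t (t + 1) (lt_add_one t)
    change N s ω ≤ N t ω
    rw [← hqe, ← hqe']
    exact h1 q hq q' hq' (hqt.trans htq).le

end IsPoissonProcess

/-! ### The law of the first passage time -/

/-- For a nondecreasing path that is constant for a while after each time, the first passage time
over `t` exceeds `u` exactly when the level `t` has not been exceeded at `u`. Without the passage,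
`sInf ∅ = 0` would break the equivalence. -/
theorem lt_sInf_setOf_lt_iff {x : ℝ≥0 → ℝ} (hmono : Monotone x)
    (hright : ∀ u, ∀ᶠ v in 𝓝[≥] u, x v = x u) {t : ℝ} (hne : ∃ u, t < x u) (u : ℝ≥0) :
    u < sInf {v | t < x v} ↔ x u ≤ t := by
  refine ⟨fun h => not_lt.1 fun ht => (csInf_le' (s := {v | t < x v}) ht).not_gt h, fun h => ?_⟩
  obtain ⟨z, hz, hsub⟩ := (mem_nhdsGE_iff_exists_Ico_subset' (lt_add_one u)).1 (hright u)
  refine lt_of_lt_of_le hz (le_csInf hne fun v hv => not_lt.1 fun hvz => ?_)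
  have hv' : t < x v := hv
  rcases le_total v u with hvu | huv
  · exact (hv'.trans_le (hmono hvu)).not_ge h
  · rw [hsub ⟨huv, hvz⟩] at hv'
    exact hv'.not_ge h

namespace IsCompoundPoissonGamma

variable {Ω : Type*} [MeasurableSpace Ω] {P : Measure Ω}
  {X : ℝ≥0 → Ω → ℝ} {lam β : ℝ≥0} {n : ℕ}

open Set in
/-- The law of `X u` on the half-lines `(-∞, t]`, by conditioning on the number of jumps. As `X` is
only almost everywhere equal to the compound sum, the event is merely null-measurable. -/
theorem measure_le [IsProbabilityMeasure P] (hX : IsCompoundPoissonGamma X lam n β P)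
    (hn : 1 ≤ n) (hlam : 0 < lam) (hβ : 0 < β) (u t : ℝ≥0) :
    NullMeasurableSet {ω | X u ω ≤ t} P ∧
      P {ω | X u ω ≤ t} = erlangPassageLaw n lam (β * t) (Ioi (u : ℝ)) := by
  obtain ⟨N, J, hN, hJm, hJ, hind, hNJ, hXe⟩ := hX
  have hset : {ω | X u ω ≤ t} =ᵐ[P]
      ⋃ j : ℕ, {ω | N u ω = j} ∩ {ω | ∑ i ∈ Finset.range j, J i ω ≤ t} := by
    filter_upwards [hXe] with ω hω
    refine propext ?_
    change X u ω ≤ t ↔ ω ∈ ⋃ j : ℕ, {ω | N u ω = j} ∩ {ω | ∑ i ∈ Finset.range j, J i ω ≤ t}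
    simp [hω u]
  have hm1 (j : ℕ) : MeasurableSet {ω | N u ω = j} := hN.measurable u (measurableSet_singleton j)
  have hm2 (j : ℕ) : MeasurableSet {ω | ∑ i ∈ Finset.range j, J i ω ≤ t} :=
    measurableSet_le (Finset.measurable_sum _ fun i _ => hJm i) measurable_const
  refine ⟨((MeasurableSet.iUnion fun j => (hm1 j).inter (hm2 j)).nullMeasurableSet).congr hset.symm,
    ?_⟩
  rw [measure_congr hset, measure_iUnion _ fun j => (hm1 j).inter (hm2 j),
    erlangPassageLaw_Ioi hn hlam]
  · refine tsum_congr fun j => ?_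
    have hi : IndepFun (fun ω => N u ω) (fun ω => ∑ i ∈ Finset.range j, J i ω) P :=
      hNJ.comp (φ := fun f : ℝ≥0 → ℕ => f u)
        (ψ := fun g : ℕ → ℝ => ∑ i ∈ Finset.range j, g i) (by fun_prop) (by fun_prop)
    have := hi.measure_inter_preimage_eq_mul {j} (Iic (t : ℝ)) .of_discrete measurableSet_Iic
    refine this.trans ?_
    congr 1
    · exact hN.measure_eq u j
    · rcases j with _ | j
      · simp [preimage]
      · have hs := hasLaw_sum_range_gammaMeasure hn (r := β) hβ hJm hJ hind j
        rw [← gammaMeasure_Iic (Nat.mul_pos j.succ_pos hn) hβ t]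
        have := hs.measure_eq (p := fun x => x ≤ (t : ℝ)) measurableSet_Iic
        simpa [Finset.sum_apply, preimage, Iic] using this
  · intro i j hij
    refine disjoint_left.2 fun ω h1 h2 => hij ?_
    exact h1.1.symm.trans h2.1

theorem ae_path (hX : IsCompoundPoissonGamma X lam n β P) :
    ∀ᵐ ω ∂P, Monotone (fun u => X u ω) ∧ ∀ u, ∀ᶠ v in 𝓝[≥] u, X v ω = X u ω := by
  obtain ⟨N, J, hN, hJm, hJ, hind, hNJ, hXe⟩ := hX
  have hJ0 : ∀ᵐ ω ∂P, ∀ i, 0 ≤ J i ω := by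
    refine ae_all_iff.2 fun i => ((hJ i).ae_iff (p := fun x => 0 ≤ x) measurableSet_Ici.mem).2 ?_
    rw [ae_iff, show {a : ℝ | ¬ 0 ≤ a} = Set.Iio 0 by ext; simp]
    exact gammaMeasure_Iio_zero _ _
  filter_upwards [hXe, hJ0, hN.ae_monotone, hN.ae_right_eventually_eq] with ω h1 h2 h3 h4
  refine ⟨fun s t hst => ?_, fun u => ?_⟩
  · simp only [h1]
    exact Finset.sum_le_sum_of_subset_of_nonneg (Finset.range_subset_range.2 (h3 hst))
      fun i _ _ => h2 i
  · filter_upwards [h4 u] with v hv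
    rw [h1, h1, hv]

open Set in
/-- The passage over `t` occurs almost surely: `P(X u ≤ t)` is the tail at `u` of a law on `ℝ`. -/
theorem ae_exists_lt [IsProbabilityMeasure P] (hX : IsCompoundPoissonGamma X lam n β P)
    (hn : 1 ≤ n) (hlam : 0 < lam) (hβ : 0 < β) (t : ℝ≥0) : ∀ᵐ ω ∂P, ∃ u, (t : ℝ) < X u ω := by
  have := isProbabilityMeasure_erlangPassageLaw n hlam (β * t)
  have hlim : Tendsto (fun m : ℕ => erlangPassageLaw n lam (β * t) (Ioi ((m : ℝ≥0) : ℝ))) atTop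
      (𝓝 0) := by
    have h := tendsto_measure_iInter_atTop (μ := erlangPassageLaw n lam (β * t))
      (s := fun m : ℕ => Ioi ((m : ℝ≥0) : ℝ)) (fun m => measurableSet_Ioi.nullMeasurableSet)
      (fun a b hab => Ioi_subset_Ioi (by simpa using hab)) ⟨0, measure_ne_top _ _⟩
    rwa [show ⋂ m : ℕ, Ioi ((m : ℝ≥0) : ℝ) = ∅ from
      eq_empty_of_forall_notMem fun x hx => by
        obtain ⟨m, hm⟩ := exists_nat_gt x
        have := mem_iInter.1 hx m
        simp at this
        linarith, measure_empty] at h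
  rw [ae_iff]
  refine le_antisymm (ge_of_tendsto' hlim fun m => ?_) zero_le
  rw [← (hX.measure_le hn hlam hβ m t).2]
  refine measure_mono fun ω hω => ?_
  simp only [mem_ofPred_eq, not_exists, not_lt] at hω
  exact hω m

open Set in
theorem hasLaw_inverseProcess [IsProbabilityMeasure P]
    (hX : IsCompoundPoissonGamma X lam n β P) (hn : 1 ≤ n) (hlam : 0 < lam) (hβ : 0 < β) (t : ℝ≥0) :
    HasLaw (fun ω => (inverseProcess X t ω : ℝ)) (erlangPassageLaw n lam (β * t)) P := by
  have := isProbabilityMeasure_erlangPassageLaw n hlam (β * t)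
  have hset (u : ℝ≥0) : {ω | u < inverseProcess X t ω} =ᵐ[P] {ω | X u ω ≤ t} := by
    filter_upwards [hX.ae_path, hX.ae_exists_lt hn hlam hβ t] with ω h1 h2
    exact propext (lt_sInf_setOf_lt_iff h1.1 h1.2 h2 u)
  have hnull : NullMeasurable (inverseProcess X t) P :=
    @measurable_of_Ioi _ (NullMeasurableSpace Ω P) _ _ _ _ _ _ _ _ fun u =>
      ((hX.measure_le hn hlam hβ u t).1.congr (hset u).symm)
  have hae : AEMeasurable (inverseProcess X t) P := hnull.aemeasurable
  have hae' : AEMeasurable (fun ω => (inverseProcess X t ω : ℝ)) P := by fun_prop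
  have := Measure.isProbabilityMeasure_map hae'
  refine ⟨hae', Measure.ext_of_Iic _ _ fun x => ?_⟩
  rcases lt_or_ge x 0 with hx | hx
  · have hle : Iic x ⊆ Iio 0 := fun y hy => lt_of_le_of_lt hy hx
    rw [measure_mono_null hle, measure_mono_null hle]
    · simp [erlangPassageLaw, Measure.sum_apply _ measurableSet_Iio, gammaMeasure_Iio_zero]
    · rw [Measure.map_apply_of_aemeasurable hae' measurableSet_Iio]
      simp [preimage]
  · rw [← compl_Ioi, prob_compl_eq_one_sub measurableSet_Ioi,
      prob_compl_eq_one_sub measurableSet_Ioi]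
    congr 1
    lift x to ℝ≥0 using hx
    rw [Measure.map_apply_of_aemeasurable hae' measurableSet_Ioi,
      ← (hX.measure_le hn hlam hβ x t).2, ← measure_congr (hset x)]
    simp [preimage]

end IsCompoundPoissonGamma

/-! ### Poisson processes at independent random times -/

theorem lintegral_indicator_singleton_comp {Ω : Type*} [MeasurableSpace Ω] {P : Measure Ω}
    {Z : Ω → ℕ} (hZ : AEMeasurable Z P) (k : ℕ) :
    ∫⁻ ω, ({k} : Set ℕ).indicator 1 (Z ω) ∂P = P {ω | Z ω = k} := by
  rw [← lintegral_map' (f := ({k} : Set ℕ).indicator 1) Measurable.of_discrete.aemeasurable hZ,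
    lintegral_indicator_one .of_discrete, Measure.map_apply_of_aemeasurable hZ .of_discrete]
  rfl

namespace IsPoissonProcess

variable {Ω : Type*} [MeasurableSpace Ω] {N : ℝ≥0 → Ω → ℕ} {lam : ℝ≥0} {P : Measure Ω}

/-- The time change at a random time with countably many values `s j`. -/
theorem measure_comp_discrete (hN : IsPoissonProcess N lam P) {Y : Ω → ℝ≥0}
    (hY : AEMeasurable Y P) (hind : ∀ s, IndepFun (N s) Y P) {D : ℝ≥0 → ℕ} (hD : Measurable D)
    (s : ℕ → ℝ≥0) (k : ℕ) :
    AEMeasurable (fun ω => N (s (D (Y ω))) ω) P ∧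
      P {ω | N (s (D (Y ω))) ω = k} = ∫⁻ ω, poissonMeasure (lam * s (D (Y ω))) {k} ∂P := by
  have hDY : AEMeasurable (fun ω => D (Y ω)) P := hD.comp_aemeasurable hY
  have hm : Measurable (fun p : ℕ × Ω => N (s p.1) p.2) :=
    measurable_from_prod_countable_right fun j => hN.measurable (s j)
  refine ⟨hm.comp_aemeasurable (hDY.prodMk aemeasurable_id), ?_⟩
  rw [← lintegral_map' (f := fun j => poissonMeasure (lam * s j) {k})
    Measurable.of_discrete.aemeasurable hDY, lintegral_countable']
  have hset : {ω | N (s (D (Y ω))) ω = k} =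
      ⋃ j : ℕ, N (s j) ⁻¹' {k} ∩ Y ⁻¹' (D ⁻¹' {j}) := by
    ext ω; simp
  have hnull (j : ℕ) : NullMeasurableSet (Y ⁻¹' (D ⁻¹' {j})) P :=
    hY.nullMeasurableSet_preimage (hD (measurableSet_singleton j))
  rw [hset, measure_iUnion₀]
  · refine tsum_congr fun j => ?_
    rw [(hind (s j)).measure_inter_preimage_eq_mul _ _ .of_discrete
      (hD (measurableSet_singleton j)), Measure.map_apply_of_aemeasurable hDY .of_discrete]
    congr 1
    exact hN.measure_eq (s j) k
  · intro i j hij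
    refine (Set.disjoint_left.2 fun ω h1 h2 => hij ?_).aedisjoint
    exact h1.2.symm.trans h2.2
  · exact fun j => ((hN.measurable (s j) (measurableSet_singleton k)).nullMeasurableSet).inter
      (hnull j)

/-- A Poisson process evaluated at a random time `Y` that is independent of each `N s` is mixed
Poisson. Only independence at fixed times is needed: `Y` is approximated from above by grid times,
and the right-continuity of the paths gives the limit. -/
theorem measure_comp (hN : IsPoissonProcess N lam P) [IsProbabilityMeasure P] {Y : Ω → ℝ≥0}
    (hY : AEMeasurable Y P) (hind : ∀ s, IndepFun (N s) Y P) (k : ℕ) :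
    AEMeasurable (fun ω => N (Y ω) ω) P ∧
      P {ω | N (Y ω) ω = k} = ∫⁻ ω, poissonMeasure (lam * Y ω) {k} ∂P := by
  let D (m : ℕ) (y : ℝ≥0) : ℕ := ⌊(m + 1) * y⌋₊
  let s (m j : ℕ) : ℝ≥0 := (j + 1) / (m + 1)
  have hD (m : ℕ) : Measurable (D m) := Nat.measurable_floor.comp (measurable_const_mul _)
  have hgt (m : ℕ) (y : ℝ≥0) : y < s m (D m y) := by
    rw [lt_div_iff₀ (by positivity), mul_comm]
    exact Nat.lt_floor_add_one _
  have hle (m : ℕ) (y : ℝ≥0) : s m (D m y) ≤ y + 1 / (m + 1) := by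
    have h : (D m y : ℝ≥0) ≤ (m + 1) * y := Nat.floor_le zero_le
    calc s m (D m y) ≤ ((m + 1) * y + 1) / (m + 1) := by
          change ((D m y : ℝ≥0) + 1) / (m + 1) ≤ _
          gcongr
      _ = y + 1 / (m + 1) := by field_simp
  have hlim (y : ℝ≥0) : Tendsto (fun m => s m (D m y)) atTop (𝓝[≥] y) := by
    refine tendsto_nhdsWithin_iff.2 ⟨?_, Eventually.of_forall fun m => (hgt m y).le⟩
    refine tendsto_of_tendsto_of_tendsto_of_le_of_le tendsto_const_nhds ?_
      (fun m => (hgt m y).le) (fun m => hle m y)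
    simpa using tendsto_const_nhds.add (tendsto_one_div_add_atTop_nhds_zero_nat (𝕜 := ℝ≥0))
  have hm (m : ℕ) := (hN.measure_comp_discrete hY hind (hD m) (s m) k).1
  have hae : ∀ᵐ ω ∂P, Tendsto (fun m => N (s m (D m (Y ω))) ω) atTop (𝓝 (N (Y ω) ω)) := by
    filter_upwards [hN.ae_right_eventually_eq] with ω hω
    exact tendsto_nhds_of_eventually_eq ((hlim (Y ω)).eventually (hω (Y ω)))
  have hZ : AEMeasurable (fun ω => N (Y ω) ω) P :=
    aemeasurable_of_tendsto_metrizable_ae atTop hm hae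
  refine ⟨hZ, ?_⟩
  have h1 : Tendsto (fun m => P {ω | N (s m (D m (Y ω))) ω = k}) atTop
      (𝓝 (P {ω | N (Y ω) ω = k})) := by
    simp_rw [← lintegral_indicator_singleton_comp (hm _), ← lintegral_indicator_singleton_comp hZ]
    refine tendsto_lintegral_of_dominated_convergence' (fun _ => 1)
      (fun m => (Measurable.of_discrete (f := ({k} : Set ℕ).indicator 1)).comp_aemeasurable (hm m))
      (fun m => ae_of_all _ fun ω => Set.indicator_le_self' (fun _ _ => zero_le) _) (by simp) ?_
    filter_upwards [hae] with ω hω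
    exact (continuous_of_discreteTopology.tendsto _).comp hω
  have hcont : Continuous fun y : ℝ≥0 => poissonMeasure (lam * y) {k} := by
    simp_rw [poissonMeasure_singleton]
    exact ENNReal.continuous_ofReal.comp (by fun_prop)
  have h2 : Tendsto (fun m => P {ω | N (s m (D m (Y ω))) ω = k}) atTop
      (𝓝 (∫⁻ ω, poissonMeasure (lam * Y ω) {k} ∂P)) := by
    simp_rw [fun m => (hN.measure_comp_discrete hY hind (hD m) (s m) k).2]
    refine tendsto_lintegral_of_dominated_convergence' (fun _ => 1)
      (fun m => ?_) (fun m => ae_of_all _ fun ω => prob_le_one) (by simp) ?_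
    · exact (Measurable.of_discrete (f := fun j => poissonMeasure (lam * s m j) {k})
        ).comp_aemeasurable ((hD m).comp_aemeasurable hY)
    · exact ae_of_all _ fun ω =>
        (hcont.tendsto _).comp ((hlim (Y ω)).mono_right nhdsWithin_le_nhds)
  exact tendsto_nhds_unique h1 h2

end IsPoissonProcess

/-! ### Mixed Poisson laws with gamma parameter -/

/-- A Poisson variable with a `Gamma(j + 1, lam)` random parameter is negative binomial: up to a
constant, the product of the two densities is the `Gamma(j + k + 1, lam + mu)` density. -/
theorem lintegral_poissonMeasure_singleton_gammaMeasure {lam mu : ℝ≥0} (hlam : 0 < lam)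
    (j k : ℕ) :
    ∫⁻ x, poissonMeasure (mu * x.toNNReal) {k} ∂gammaMeasure (j + 1) lam =
      ENNReal.ofReal ((k + j).choose k * (lam : ℝ) ^ (j + 1) * (mu : ℝ) ^ k /
        ((mu : ℝ) + lam) ^ (k + j + 1)) := by
  have hlam' : (0 : ℝ) < lam := hlam
  have hs : (0 : ℝ) < mu + lam := by positivity
  rw [gammaMeasure, lintegral_withDensity_eq_lintegral_mul _ (by unfold gammaPDF; fun_prop) (by
    simp_rw [poissonMeasure_singleton]
    fun_prop)]
  rw [← mul_one (ENNReal.ofReal _), ← lintegral_gammaPDF_eq_one (a := (k + j : ℕ) + 1)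
    (r := mu + lam) (by positivity) hs, ← lintegral_const_mul _ (by unfold gammaPDF; fun_prop)]
  refine lintegral_congr fun x => ?_
  rw [Pi.mul_apply]
  rcases lt_or_ge x 0 with hx | hx
  · simp [gammaPDF_of_neg hx]
  rw [gammaPDF_of_nonneg hx, gammaPDF_of_nonneg hx, poissonMeasure_singleton,
    ← ENNReal.ofReal_mul (by positivity), ← ENNReal.ofReal_mul (by positivity),
    Nat.cast_add_choose ℝ,
    Real.Gamma_nat_eq_factorial, Real.Gamma_nat_eq_factorial, add_sub_cancel_right,
    add_sub_cancel_right, Real.rpow_natCast, Real.rpow_natCast, ← Nat.cast_add_one,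
    ← Nat.cast_add_one, Real.rpow_natCast, Real.rpow_natCast, NNReal.coe_mul,
    Real.coe_toNNReal _ hx, show -((mu + lam) * x) = -(lam * x) + -(mu * x) by ring, Real.exp_add]
  congr 1
  field_simp
  ring

/-! ### Series -/

open Finset in
/-- Grouping the Poisson series by the quotient and the remainder of the index modulo `n`. -/
theorem tsum_poisson_mul_div {n : ℕ} (hn : 1 ≤ n) (b : ℝ) (c : ℕ → ℝ)
    (hc : Summable fun i : ℕ => Real.exp (-b) * b ^ i / i.factorial * c (i / n)) :
    ∑' i : ℕ, Real.exp (-b) * b ^ i / i.factorial * c (i / n) =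
      Real.exp (-b) * ∑ m ∈ Icc 1 n, b ^ (m - 1) *
        ∑' j : ℕ, c j * ((b ^ n) ^ j / Real.Gamma ((n : ℝ) * j + m)) := by
  have : NeZero n := ⟨by omega⟩
  let e : Fin n × ℕ ≃ ℕ := (Equiv.prodComm _ _).trans (Nat.divModEquiv n).symm
  have he (p : Fin n × ℕ) : e p = p.2 * n + p.1 := rfl
  rw [← e.tsum_eq, Summable.tsum_prod
      (f := fun p => Real.exp (-b) * b ^ e p / (e p).factorial * c (e p / n))
      (e.summable_iff.2 hc), tsum_fintype, Finset.mul_sum,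
    ← Finset.Ico_add_one_right_eq_Icc, Finset.sum_Ico_eq_sum_range, Nat.add_sub_cancel,
    ← Fin.sum_univ_eq_sum_range (fun r => Real.exp (-b) * (b ^ (1 + r - 1) *
        ∑' j : ℕ, c j * ((b ^ n) ^ j / Real.Gamma ((n : ℝ) * j + (1 + r : ℕ)))))]
  refine Finset.sum_congr rfl fun r _ => ?_
  rw [← tsum_mul_left, ← tsum_mul_left]
  refine tsum_congr fun j => ?_
  have hdiv : (j * n + r) / n = j := by
    rw [mul_comm, Nat.mul_add_div (by omega), Nat.div_eq_of_lt r.2, add_zero]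
  have hG : Real.Gamma ((n : ℝ) * j + (1 + r : ℕ)) = (j * n + r : ℕ).factorial := by
    rw [← Real.Gamma_nat_eq_factorial]
    congr 1
    push_cast
    ring
  rw [he, hdiv, hG, Nat.add_sub_cancel_left, pow_add, ← pow_mul, mul_comm n j]
  ring

theorem tsum_mul_eq_mittagLefflerThree (n m k : ℕ) {lam mu : ℝ} (hs : mu + lam ≠ 0) (z : ℝ) :
    ∑' j : ℕ, ((k + j).choose k * lam ^ (j + 1) * mu ^ k / (mu + lam) ^ (k + j + 1)) *
        (z ^ j / Real.Gamma ((n : ℝ) * j + m)) =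
      lam * mu ^ k / (mu + lam) ^ (k + 1) *
        mittagLefflerThree n m (k + 1) (lam * z / (mu + lam)) := by
  rw [mittagLefflerThree, ← tsum_mul_left]
  refine tsum_congr fun j => ?_
  have hG : Real.Gamma ((k : ℝ) + 1 + j) = (k + j).factorial := by
    rw [← Real.Gamma_nat_eq_factorial]
    congr 1
    push_cast
    ring
  rw [Nat.cast_add_choose ℝ, hG, Real.Gamma_nat_eq_factorial, div_pow, mul_pow]
  field_simp
  ring

theorem tsum_mul_eq_mittagLefflerTwo (n m : ℕ) (q z : ℝ) :
    ∑' j : ℕ, q ^ (j + 1) * (z ^ j / Real.Gamma ((n : ℝ) * j + m)) =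
      q * mittagLefflerTwo n m (q * z) := by
  rw [mittagLefflerTwo, ← tsum_mul_left]
  refine tsum_congr fun j => ?_
  ring

theorem summable_poisson_mul_pow_div {b q : ℝ} (hb : 0 ≤ b) (hq : 0 ≤ q) (n : ℕ) :
    Summable fun i : ℕ => Real.exp (-b) * b ^ i / i.factorial * q ^ (i / n + 1) := by
  have h := ((Real.summable_pow_div_factorial (b * max 1 q)).mul_left
    (Real.exp (-b) * max 1 q))
  refine Summable.of_nonneg_of_le (fun i => by positivity) (fun i => ?_) h
  have hle : q ^ (i / n + 1) ≤ max 1 q ^ (i + 1) :=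
    (pow_le_pow_left₀ hq (le_max_right _ _) _).trans
      (pow_le_pow_right₀ (le_max_left _ _) (by gcongr; exact Nat.div_le_self i n))
  calc _ ≤ Real.exp (-b) * b ^ i / i.factorial * max 1 q ^ (i + 1) := by gcongr
    _ = _ := by rw [mul_pow]; ring

/-- The Laplace transform of a negative binomial distribution. -/
theorem hasSum_exp_mul_choose_mul_pow {lam mu θ : ℝ} (hlam : 0 < lam) (hmu : 0 < mu)
    (hθ : 0 < lam + mu * (1 - Real.exp (-θ))) (j : ℕ) :
    HasSum (fun k : ℕ => Real.exp (-θ * k) *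
        ((k + j).choose k * lam ^ (j + 1) * mu ^ k / (mu + lam) ^ (k + j + 1)))
      ((lam / (lam + mu * (1 - Real.exp (-θ)))) ^ (j + 1)) := by
  have hs : 0 < mu + lam := by positivity
  have hx : ‖mu * Real.exp (-θ) / (mu + lam)‖ < 1 := by
    rw [Real.norm_of_nonneg (by positivity), div_lt_one hs]
    linarith
  have h1 : 1 - mu * Real.exp (-θ) / (mu + lam) =
      (lam + mu * (1 - Real.exp (-θ))) / (mu + lam) := by
    field_simp
    ring
  have h := (hasSum_choose_mul_geometric_of_norm_lt_one j hx).mul_left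
    ((lam / (mu + lam)) ^ (j + 1))
  rw [h1] at h
  rw [show (lam / (lam + mu * (1 - Real.exp (-θ)))) ^ (j + 1) = (lam / (mu + lam)) ^ (j + 1) *
    (1 / ((lam + mu * (1 - Real.exp (-θ))) / (mu + lam)) ^ (j + 1)) by
      rw [← one_div_pow, ← mul_pow]
      congr 1
      field_simp]
  convert! h using 2 with k
  rw [Nat.choose_symm_add, mul_comm (-θ), Real.exp_nat_mul, div_pow, div_pow, mul_pow]
  field_simp
  ring

/-! ### The time-changed process -/

section FirstPassage

variable {Ω : Type*} [MeasurableSpace Ω] {P : Measure Ω} [IsProbabilityMeasure P]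
  {n : ℕ} {lam lam1 β : ℝ≥0} {X : ℝ≥0 → Ω → ℝ} {N1 : ℝ≥0 → Ω → ℕ}

/-- The law of `N1(Y(t))` as a Poisson(`β t`) average of negative binomial weights. -/
theorem aemeasurable_timeChange_and_measure_eq_tsum (hn : 1 ≤ n) (hlam : 0 < lam) (hβ : 0 < β)
    (hX : IsCompoundPoissonGamma X lam n β P) (hN1 : IsPoissonProcess N1 lam1 P)
    (hindep : IndepFun (fun ω s => N1 s ω) (fun ω s => inverseProcess X s ω) P)
    (t : ℝ≥0) (k : ℕ) :
    AEMeasurable (timeChange N1 (inverseProcess X) t) P ∧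
      P {ω | timeChange N1 (inverseProcess X) t ω = k} =
        ∑' i : ℕ, ENNReal.ofReal (Real.exp (-(β * t)) * (β * t) ^ i / i.factorial *
          ((k + i / n).choose k * (lam : ℝ) ^ (i / n + 1) * (lam1 : ℝ) ^ k /
            ((lam1 : ℝ) + lam) ^ (k + i / n + 1))) := by
  have hlaw := hX.hasLaw_inverseProcess hn hlam hβ t
  have hY : AEMeasurable (inverseProcess X t) P := by
    simpa using hlaw.aemeasurable.real_toNNReal
  have hi (s : ℝ≥0) : IndepFun (N1 s) (inverseProcess X t) P :=
    hindep.comp (φ := fun f : ℝ≥0 → ℕ => f s) (ψ := fun g : ℝ≥0 → ℝ≥0 => g t)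
      (by fun_prop) (by fun_prop)
  obtain ⟨h1, h2⟩ := hN1.measure_comp hY hi k
  refine ⟨h1, h2.trans ?_⟩
  have hm : Measurable fun x : ℝ => poissonMeasure (lam1 * x.toNNReal) {k} := by
    simp_rw [poissonMeasure_singleton]
    fun_prop
  have h3 := hlaw.lintegral_comp hm.aemeasurable
  simp only [Real.toNNReal_coe] at h3
  rw [h3, erlangPassageLaw, lintegral_sum_measure]
  refine tsum_congr fun i => ?_
  rw [lintegral_smul_measure, lintegral_poissonMeasure_singleton_gammaMeasure hlam,
    poissonMeasure_singleton, smul_eq_mul, ← ENNReal.ofReal_mul (by positivity)]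
  simp

theorem measureReal_timeChange_eq (hn : 1 ≤ n) (hlam : 0 < lam) (hβ : 0 < β)
    (hX : IsCompoundPoissonGamma X lam n β P) (hN1 : IsPoissonProcess N1 lam1 P)
    (hindep : IndepFun (fun ω s => N1 s ω) (fun ω s => inverseProcess X s ω) P)
    (t : ℝ≥0) (k : ℕ) :
    P.real {ω | timeChange N1 (inverseProcess X) t ω = k} =
      Real.exp (-(β * t)) * ((lam : ℝ) * (lam1 : ℝ) ^ k / ((lam1 : ℝ) + lam) ^ (k + 1)) *
        ∑ m ∈ Finset.Icc 1 n, ((β : ℝ) * t) ^ (m - 1) *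
          mittagLefflerThree n m ((k : ℝ) + 1)
            ((lam : ℝ) * (β * t) ^ n / ((lam1 : ℝ) + lam)) := by
  have hlam' : (0 : ℝ) < lam := hlam
  have h := (aemeasurable_timeChange_and_measure_eq_tsum hn hlam hβ hX hN1 hindep t k).2
  have hfin := h ▸ measure_ne_top P {ω | timeChange N1 (inverseProcess X) t ω = k}
  have hsum := ENNReal.summable_toReal hfin
  rw [measureReal_def, h, ENNReal.tsum_toReal_eq fun i => ENNReal.ofReal_ne_top]
  have hnonneg (i : ℕ) : 0 ≤ Real.exp (-(β * t)) * ((β : ℝ) * t) ^ i / i.factorial *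
      ((k + i / n).choose k * (lam : ℝ) ^ (i / n + 1) * (lam1 : ℝ) ^ k /
        ((lam1 : ℝ) + lam) ^ (k + i / n + 1)) := by positivity
  simp_rw [fun i => ENNReal.toReal_ofReal (hnonneg i)] at hsum ⊢
  rw [tsum_poisson_mul_div hn (β * t) (fun j => (k + j).choose k * (lam : ℝ) ^ (j + 1) *
    (lam1 : ℝ) ^ k / ((lam1 : ℝ) + lam) ^ (k + j + 1)) hsum]
  simp_rw [tsum_mul_eq_mittagLefflerThree n _ k (by positivity : (lam1 : ℝ) + lam ≠ 0)]
  rw [mul_assoc, Finset.mul_sum _ _ (_ / _)]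
  congr 1
  refine Finset.sum_congr rfl fun m _ => ?_
  ring

theorem integrable_and_integral_exp_timeChange (hn : 1 ≤ n) (hlam : 0 < lam) (hlam1 : 0 < lam1)
    (hβ : 0 < β) (hX : IsCompoundPoissonGamma X lam n β P) (hN1 : IsPoissonProcess N1 lam1 P)
    (hindep : IndepFun (fun ω s => N1 s ω) (fun ω s => inverseProcess X s ω) P)
    (t : ℝ≥0) {θ : ℝ} (hθ : 0 < (lam : ℝ) + lam1 * (1 - Real.exp (-θ))) :
    Integrable (fun ω => Real.exp (-θ * (timeChange N1 (inverseProcess X) t ω : ℝ))) P ∧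
      ∫ ω, Real.exp (-θ * (timeChange N1 (inverseProcess X) t ω : ℝ)) ∂P =
        Real.exp (-(β * t)) * ((lam : ℝ) / ((lam : ℝ) + lam1 * (1 - Real.exp (-θ)))) *
          ∑ m ∈ Finset.Icc 1 n, ((β : ℝ) * t) ^ (m - 1) *
            mittagLefflerTwo n m
              ((lam : ℝ) * (β * t) ^ n / ((lam : ℝ) + lam1 * (1 - Real.exp (-θ)))) := by
  set Z := timeChange N1 (inverseProcess X) t with hZdef
  have hlam' : (0 : ℝ) < lam := hlam
  have hlam1' : (0 : ℝ) < lam1 := hlam1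
  set q : ℝ := (lam : ℝ) / ((lam : ℝ) + lam1 * (1 - Real.exp (-θ))) with hq
  have hq0 : 0 < q := div_pos hlam' hθ
  have hlaw := aemeasurable_timeChange_and_measure_eq_tsum hn hlam hβ hX hN1 hindep t
  simp only [← hZdef] at hlaw
  have hZ : AEMeasurable Z P := (hlaw 0).1
  have hsum := summable_poisson_mul_pow_div (b := (β : ℝ) * t) (by positivity) hq0.le n
  have hnonneg (i : ℕ) :
      0 ≤ Real.exp (-(β * t)) * ((β : ℝ) * t) ^ i / i.factorial * q ^ (i / n + 1) := by
    positivity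
  have hlint : ∫⁻ ω, ENNReal.ofReal (Real.exp (-θ * (Z ω : ℝ))) ∂P = ENNReal.ofReal
      (∑' i : ℕ, Real.exp (-(β * t)) * ((β : ℝ) * t) ^ i / i.factorial * q ^ (i / n + 1)) := by
    rw [← lintegral_map' (f := fun k : ℕ => ENNReal.ofReal (Real.exp (-θ * (k : ℝ))))
      Measurable.of_discrete.aemeasurable hZ, lintegral_countable',
      ENNReal.ofReal_tsum_of_nonneg hnonneg hsum]
    have hmap (k : ℕ) : P.map Z {k} = P {ω | Z ω = k} :=
      Measure.map_apply_of_aemeasurable hZ .of_discrete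
    simp_rw [hmap, fun k => (hlaw k).2, ← ENNReal.tsum_mul_left]
    rw [ENNReal.tsum_comm]
    refine tsum_congr fun i => ?_
    have h := (hasSum_exp_mul_choose_mul_pow hlam' hlam1' hθ (i / n)).mul_left
      (Real.exp (-(β * t)) * ((β : ℝ) * t) ^ i / i.factorial)
    rw [← h.tsum_eq, ENNReal.ofReal_tsum_of_nonneg (fun k => by positivity) h.summable]
    refine tsum_congr fun k => ?_
    rw [← ENNReal.ofReal_mul (by positivity)]
    congr 1
    ring
  have hmeas : AEStronglyMeasurable (fun ω => Real.exp (-θ * (Z ω : ℝ))) P :=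
    ((Measurable.of_discrete (f := fun k : ℕ => Real.exp (-θ * (k : ℝ)))).comp_aemeasurable
      hZ).aestronglyMeasurable
  refine ⟨⟨hmeas, ?_⟩, ?_⟩
  · rw [hasFiniteIntegral_iff_ofReal (ae_of_all _ fun ω => by positivity), hlint]
    exact ENNReal.ofReal_lt_top
  · rw [integral_eq_lintegral_of_nonneg_ae (ae_of_all _ fun ω => by positivity) hmeas, hlint,
      ENNReal.toReal_ofReal (tsum_nonneg hnonneg),
      tsum_poisson_mul_div hn (β * t) (fun j => q ^ (j + 1)) hsum]
    simp_rw [tsum_mul_eq_mittagLefflerTwo]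
    rw [mul_assoc, Finset.mul_sum _ _ q]
    congr 1
    refine Finset.sum_congr rfl fun m _ => ?_
    rw [mul_div_right_comm (lam : ℝ), ← hq]
    ring

end FirstPassage

theorem theorem9 {Ω : Type*} [MeasurableSpace Ω] (P : Measure Ω) [IsProbabilityMeasure P]
    (n : ℕ) (hn : 1 ≤ n) (lam lam1 : ℝ≥0) (β : ℝ) (hlam : 0 < lam) (hlam1 : 0 < lam1)
    (hβ : 0 < β)
    (X : ℝ≥0 → Ω → ℝ) (hX : IsCompoundPoissonGamma X lam (n : ℝ) β P)
    (N1 : ℝ≥0 → Ω → ℕ) (hN1 : IsPoissonProcess N1 lam1 P)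
    (hindep : IndepFun (fun ω s => N1 s ω) (fun ω s => inverseProcess X s ω) P) :
    (∀ (t : ℝ≥0) (k : ℕ),
      P.real {ω | timeChange N1 (inverseProcess X) t ω = k} =
        Real.exp (-(β * t)) * ((lam : ℝ) * (lam1 : ℝ) ^ k / ((lam1 : ℝ) + lam) ^ (k + 1)) *
          ∑ m ∈ Finset.Icc 1 n, (β * t) ^ (m - 1) *
            mittagLefflerThree n m ((k : ℝ) + 1)
              ((lam : ℝ) * (β * t) ^ n / ((lam1 : ℝ) + lam))) ∧
    (∀ (t : ℝ≥0) (θ : ℝ), 0 < (lam : ℝ) + lam1 * (1 - Real.exp (-θ)) →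
      Integrable (fun ω => Real.exp (-θ * (timeChange N1 (inverseProcess X) t ω : ℝ))) P ∧
      ∫ ω, Real.exp (-θ * (timeChange N1 (inverseProcess X) t ω : ℝ)) ∂P =
        Real.exp (-(β * t)) * ((lam : ℝ) / ((lam : ℝ) + lam1 * (1 - Real.exp (-θ)))) *
          ∑ m ∈ Finset.Icc 1 n, (β * t) ^ (m - 1) *
            mittagLefflerTwo n m
              ((lam : ℝ) * (β * t) ^ n / ((lam : ℝ) + lam1 * (1 - Real.exp (-θ))))) := by
  lift β to ℝ≥0 using hβ.le
  exact ⟨measureReal_timeChange_eq hn hlam hβ hX hN1 hindep, fun t _ =>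
    integrable_and_integral_exp_timeChange hn hlam hlam1 hβ hX hN1 hindep t⟩
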